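/- Let $L$ be a first-order language and let $\mathcal U$ be a saturated $L$-structure whose cardinality $\kappa$ is (uncountable) inaccessible, Ramsey, and larger than $|L|$. Let $A\subseteq\mathcal U$ with $|A|<\kappa$, let $n<\omega$, and let $\mathcal D\subseteq\mathcal U^n$ be an arbitrary set. For $\mathcal S\subseteq\mathcal U^m$ write $\langle\mathcal U,\mathcal S\rangle$ for the expansion of $\mathcal U$ by an $m$-ary predicate for $\mathcal S$, and let $$e(\mathcal S)=\{\mathcal C\subseteq\mathcal U^m : \langle\mathcal U,\mathcal C\rangle\equiv\langle\mathcal U,\mathcal S\rangle\}.$$ A set $u\subseteq\mathcal P(\mathcal U^m)$ shatters $B\subseteq\mathcal U^m$ if every $H\subseteq B$ is of the form $\mathcal C\cap B$ with $\mathcal C\in u$; it has finite VC-dimension if for some $N<\omega$ no set of size $N$ is shattered by $u$. Let $\mathrm{Aut}(\mathcal U/A)$ be the group of automorphisms of $\mathcal U$ fixing $A$ pointwise. A set $\mathcal S\subseteq\mathcal U^m$ is invariant over $A$ if $f[\mathcal S]=\mathcal S$ for every $f\in\mathrm{Aut}(\mathcal U/A)$; it is Lascar invariant over $A$ if it is invariant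 over every elementary substructure $M\preceq\mathcal U$ with $A\subseteq M$ and $|M|<\kappa$. For $b\in\mathcal U^m$ let $o(b/A)=\{f(b):f\in\mathrm{Aut}(\mathcal U/A)\}$. A set $u\subseteq\mathcal P(\mathcal U^m)$ locally covers $\mathcal B\subseteq\mathcal U^m$ if for every $\mathcal K\subseteq\mathcal B$ of cardinality $\kappa$ and every $k<\omega$ there is $\mathcal C\in u$ with $|\mathcal K\cap\mathcal C|\ge k$. A set $\mathcal S\subseteq\mathcal U^m$ is pseudo-invariant over $A$ if $e(\mathcal S)$ locally covers $o(b/A)$ for every $b\in\mathcal S$. Suppose that $e(\mathcal D)$ has finite VC-dimension. Then the following are equivalent: 1. $\mathcal D$ is Lascar invariant over $A$; 2. for every $m<\omega$, every set $\mathcal S\subseteq\mathcal U^m$ that is definable in $\langle\mathcal U,\mathcal D\rangle$ with parameters from $A$ is pseudo-invariant over $A$; 3. $\mathcal D\times\neg\mathcal D=\{(a,b)\in\mathcal U^n\times\mathcal U^n : a\in\mathcal D,\ b\notin\mathcal D\}$ is pseudo-invariant over $A$. -/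

import Mathlib

universe u v w

namespace PseudoInv

open scoped FirstOrder

/-- The only symbol of the language of an `n`-ary predicate. -/
inductive PredSymbol (n : ℕ) : ℕ → Type
  | mem : PredSymbol n n

/-- The language with a single relation symbol, of arity `n`. -/
def predLang (n : ℕ) : FirstOrder.Language.{0, 0} := ⟨fun _ => Empty, PredSymbol n⟩

/-- The interpretation of the predicate as the set `D`. -/
@[reducible] def predStructure {U : Type w} {n : ℕ} (D : Set (Fin n → U)) : (predLang n).Structure U where
  funMap := fun f => Empty.elim f
  RelMap := fun r => match r with
    | .mem => fun x => x ∈ D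

variable (L : FirstOrder.Language.{u, v}) {U : Type w} [L.Structure U]

/-- `L` together with an `n`-ary predicate. -/
abbrev expLang (n : ℕ) : FirstOrder.Language.{u, v} := L.sum (predLang n)

/-- The expansion `⟨U, D⟩` of `U`. -/
@[reducible] def expansion {n : ℕ} (D : Set (Fin n → U)) : (expLang L n).Structure U :=
  letI := predStructure D
  inferInstance

theorem expansion_relMap_mem {n : ℕ} (D : Set (Fin n → U)) (x : Fin n → U) :
    (expansion L D).RelMap (Sum.inr PredSymbol.mem : (expLang L n).Relations n) x ↔ x ∈ D :=
  Iff.rfl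

/-- `e(D)`: the sets `C` such that `⟨U, C⟩` and `⟨U, D⟩` are elementarily equivalent. -/
def eqClass {n : ℕ} (D : Set (Fin n → U)) : Set (Set (Fin n → U)) :=
  {C | @FirstOrder.Language.ElementarilyEquivalent (expLang L n) U U (expansion L C) (expansion L D)}

/-- `S` is defined by a formula of `L(A; D)`, that is, of the language of `⟨U, D⟩` with parameters
from `A`. -/
def DefinableWith {n m : ℕ} (A : Set U) (D : Set (Fin n → U)) (S : Set (Fin m → U)) : Prop :=
  @Set.Definable U A (expLang L n) (expansion L D) (Fin m) S

/-- `Aut(U/A)`. -/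
def autOver (A : Set U) : Set (U ≃[L] U) := {f | ∀ a ∈ A, f a = a}

/-- `o(b/A)`, the orbit of a finite tuple. -/
def orbit {n : ℕ} (A : Set U) (b : Fin n → U) : Set (Fin n → U) :=
  {c | ∃ f ∈ autOver L A, c = fun i => f (b i)}

/-- `o(D/A)`, the orbit of a set of `n`-tuples. -/
def setOrbit {n : ℕ} (A : Set U) (D : Set (Fin n → U)) : Set (Set (Fin n → U)) :=
  {C | ∃ f ∈ autOver L A, C = (fun x : Fin n → U => fun i => f (x i)) '' D}

/-- `D` is invariant over `A`. -/
def InvariantOver {n : ℕ} (A : Set U) (D : Set (Fin n → U)) : Prop :=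
  setOrbit L A D = {D}

/-- `D` is Lascar invariant over `A`: it is invariant over every (small) model containing `A`. -/
def LascarInvariantOver {n : ℕ} (A : Set U) (D : Set (Fin n → U)) : Prop :=
  ∀ M : L.ElementarySubstructure U, Cardinal.mk M < Cardinal.mk U → A ⊆ (M : Set U) →
    InvariantOver L (M : Set U) D

/-- `U` is saturated: every set of formulas in finitely many variables, with parameters from a set
of cardinality less than that of `U`, which is finitely satisfiable in `U` is realized in `U`. -/
def IsSaturated (U : Type w) [L.Structure U] : Prop :=
  ∀ A : Set U, Cardinal.mk A < Cardinal.mk U →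
    ∀ (m : ℕ) (p : Set (L[[A]].Formula (Fin m))),
      (∀ q : Finset (L[[A]].Formula (Fin m)), (q : Set (L[[A]].Formula (Fin m))) ⊆ p →
        ∃ x : Fin m → U, ∀ φ ∈ q, φ.Realize x) →
      ∃ x : Fin m → U, ∀ φ ∈ p, φ.Realize x

/-- `u` locally covers `B`. -/
def LocallyCovers {n : ℕ} (u : Set (Set (Fin n → U))) (B : Set (Fin n → U)) : Prop :=
  ∀ K ⊆ B, Cardinal.mk K = Cardinal.mk U → ∀ k : ℕ, ∃ C ∈ u,
    (k : Cardinal) ≤ Cardinal.mk (K ∩ C : Set (Fin n → U))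

/-- `D` is pseudo-invariant over `A`. -/
def PseudoInvariantOver {n : ℕ} (A : Set U) (D : Set (Fin n → U)) : Prop :=
  ∀ b ∈ D, LocallyCovers (eqClass L D) (orbit L A b)

/-- `D × ¬D`, as a set of `(n + n)`-tuples. -/
def prodCompl {n : ℕ} (D : Set (Fin n → U)) : Set (Fin (n + n) → U) :=
  {x | (fun i => x (Fin.castAdd n i)) ∈ D ∧ (fun i => x (Fin.natAdd n i)) ∉ D}

/-- `u` shatters `B`: every subset of `B` is the trace over `B` of a member of `u`. -/
def Shatters {X : Type w} (u : Set (Set X)) (B : Set X) : Prop :=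
  ∀ H ⊆ B, ∃ C ∈ u, C ∩ B = H

/-- The VC-dimension of `u` is finite. -/
def FiniteVCDim {X : Type w} (u : Set (Set X)) : Prop :=
  ∃ N : ℕ, ∀ B : Finset X, B.card = N → ¬ Shatters u (B : Set X)

/-- `κ` is a Ramsey cardinal: it is uncountable and for every colouring with two colours of the
finite subsets of a set of cardinality `κ` there is a subset `H` of cardinality `κ` such that, for
each `k`, all `k`-element subsets of `H` have the same colour. -/
def IsRamsey (κ : Cardinal.{w}) : Prop :=
  Cardinal.aleph0 < κ ∧ ∀ X : Type w, Cardinal.mk X = κ → ∀ c : Finset X → Bool,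
    ∃ H : Set X, Cardinal.mk H = κ ∧
      ∀ s t : Finset X, (s : Set X) ⊆ H → (t : Set X) ⊆ H → s.card = t.card → c s = c t

end PseudoInv

/-!
A set definable over `A` from a Lascar invariant set is again Lascar invariant, so (1) ⇒ (2) only
asks that a Lascar invariant `S` be pseudo-invariant. Let `b ∈ S`, let `K ⊆ o(b/A)` have cardinality
`κ`, and let `M ⊇ A` be a small model. As `κ` is a strong limit, there are fewer than `κ` types over
`M`, so some infinite `T ⊆ K` consists of tuples of the same type over `M`. If `f b ∈ T` with
`f ∈ Aut(U/A)`, then `f[S]` belongs to `e(S)`, is invariant over `M` and contains `f b`, hence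
contains `T`.

For (3) ⇒ (1), suppose that `a ∈ D` and `b ∉ D` have the same type over a small model `M ⊇ A`. The
type over `M` of `a` and `b` has a coheir; let `c` be a Morley sequence of it, of length `κ`, such
that both `a, c` and `b, c` are Morley sequences. All consecutive pairs of `c` lie in the orbit over
`A` of `(a, c₀)` and of `(b, c₀)`. According to whether `c₀ ∈ D`, one of `(a, c₀)` and `(c₀, b)` is
in `D × ¬D`, so pseudo-invariance yields `D' ∈ e(D)` that separates, always in the same direction,
arbitrarily many consecutive pairs of `c`. Choosing one element from each of these pairs realizes
any prescribed pattern of membership in `D'`; by indiscernibility `e(D)` shatters arbitrarily large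
finite sets.
-/

namespace PseudoInv

open FirstOrder Language Cardinal

section Recursion

theorem exists_transfinite_choice {I X : Type*} [Preorder I] [WellFoundedLT I]
    {P : (i : I) → (Set.Iio i → X) → X → Prop} (h : ∀ i f, ∃ x, P i f x) :
    ∃ f : I → X, ∀ i, P i (fun j => f j) (f i) := by
  choose G hG using h
  let f : I → X := WellFoundedLT.fix fun i f => G i fun j => f j.1 j.2
  have hf (i : I) : f i = G i fun j => f j := WellFoundedLT.fix_eq _ i
  exact ⟨f, fun i => hf i ▸ hG i _⟩

theorem mem_of_subset_of_isOfFiniteCharacter {X : Type*} {P : Set (Set X)}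
    (hP : Order.IsOfFiniteCharacter P) {S T : Set X} (hT : T ∈ P) (hST : S ⊆ T) : S ∈ P :=
  (hP S).2 fun Y hY hYfin => (hP T).1 hT Y (hY.trans hST) hYfin

theorem union_image_mem_of_isOfFiniteCharacter {I X : Type*} [LinearOrder I] {P : Set (Set X)}
    (hP : Order.IsOfFiniteCharacter P) {R : Set X} (hR : R ∈ P) {f : I → X} {J : Set I}
    (hJ : ∀ j ∈ J, insert (f j) (R ∪ f '' Set.Iio j) ∈ P) : R ∪ f '' J ∈ P := by
  classical
  refine (hP _).2 fun Y hY hYfin => ?_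
  have hfin : (Y \ R).Finite := hYfin.subset Set.sdiff_subset
  have hdiff : (hfin.toFinset : Set X) ⊆ f '' J := by
    rw [Set.Finite.coe_toFinset]
    exact Set.sdiff_subset_iff.2 hY
  obtain ⟨J₀, hJ₀, hfJ₀⟩ := Finset.subset_set_image_iff.1 hdiff
  have hYJ₀ : Y ⊆ R ∪ f '' J₀ := by
    rw [← Finset.coe_image, hfJ₀, Set.Finite.coe_toFinset, Set.union_sdiff_self]
    exact Set.subset_union_right
  rcases J₀.eq_empty_or_nonempty with rfl | hne
  · exact mem_of_subset_of_isOfFiniteCharacter hP hR (by simpa using hYJ₀)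
  · refine mem_of_subset_of_isOfFiniteCharacter hP (hJ _ (hJ₀ (J₀.max'_mem hne)))
      (hYJ₀.trans ?_)
    rintro x (hx | ⟨j, hj, rfl⟩)
    · exact Or.inr (Or.inl hx)
    · rcases (J₀.le_max' j hj).eq_or_lt with hj' | hj'
      · exact Or.inl (congrArg f hj')
      · exact Or.inr (Or.inr ⟨j, hj', rfl⟩)

theorem exists_superset_of_isOfFiniteCharacter {X ι : Type w} {κ : Cardinal.{w}}
    {P : Set (Set X)} (hP : Order.IsOfFiniteCharacter P) (hκ : ℵ₀ ≤ κ) (hι : #ι ≤ κ)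
    {C : ι → X → Prop} (hext : ∀ R ∈ P, #R < κ → ∀ i, ∃ x, C i x ∧ insert x R ∈ P)
    {R : Set X} (hR : R ∈ P) (hRκ : #R < κ) : ∃ S ∈ P, R ⊆ S ∧ ∀ i, ∃ x ∈ S, C i x := by
  obtain ⟨e⟩ : Nonempty ((#ι).ord.ToType ≃ ι) := Cardinal.eq.1 (mk_ord_toType _)
  obtain ⟨f, hf⟩ : ∃ f : (#ι).ord.ToType → X, ∀ i, R ∪ Set.range (fun j : Set.Iio i => f j) ∈ P →
      C (e i) (f i) ∧ insert (f i) (R ∪ Set.range fun j : Set.Iio i => f j) ∈ P := by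
    refine exists_transfinite_choice (P := fun i f x => R ∪ Set.range f ∈ P →
      C (e i) x ∧ insert x (R ∪ Set.range f) ∈ P) fun i f => ?_
    by_cases hmem : R ∪ Set.range f ∈ P
    · have hcard : #(R ∪ Set.range f : Set X) < κ :=
        (mk_union_le _ _).trans_lt (add_lt_of_lt hκ hRκ
          (mk_range_le.trans_lt ((mk_Iio_lt i (by simp)).trans_le (by simpa))))
      exact (hext _ hmem hcard (e i)).imp fun x hx _ => hx
    · exact (hext R hR hRκ (e i)).imp fun x _ h => (hmem h).elim
  simp only [← Set.image_eq_range] at hf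
  have hmem (i) : R ∪ f '' Set.Iio i ∈ P := by
    induction i using WellFoundedLT.induction with
    | ind i ih => exact union_image_mem_of_isOfFiniteCharacter hP hR fun j hj => (hf j (ih j hj)).2
  refine ⟨R ∪ f '' Set.univ, union_image_mem_of_isOfFiniteCharacter hP hR fun j _ =>
    (hf j (hmem j)).2, Set.subset_union_left, e.surjective.forall.2 fun i =>
      ⟨f i, Or.inr (Set.mem_image_of_mem f (Set.mem_univ i)), (hf i (hmem i)).1⟩⟩

end Recursion

section Types

variable (L : FirstOrder.Language.{u, v}) {U V : Type w} [L.Structure U] [L.Structure V]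

/-- The families `s` and `t`, possibly in different structures, have the same type over the empty
set. -/
def SameType {α : Type*} (s : α → U) (t : α → V) : Prop :=
  ∀ φ : L.Formula α, φ.Realize s ↔ φ.Realize t

/-- The relation `R` is elementary: its two projections enumerate families of the same type. These
relations, which are the graphs of the partial elementary maps, form the back-and-forth system in
the proof of homogeneity. -/
def IsElementaryRel (R : Set (U × V)) : Prop :=
  SameType L (fun z : R => z.1.1) (fun z : R => z.1.2)

/-- The families `s` and `t` have the same type over `B`; the elements of `B` are treated as
additional entries of the families. -/
def SameTypeOver (B : Set U) {α : Type*} (s t : α → U) : Prop :=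
  SameType L (Sum.elim ((↑) : B → U) s) (Sum.elim ((↑) : B → U) t)

variable {L}

namespace SameType

variable {α β : Type*} {s : α → U} {t : α → V}

theorem symm (h : SameType L s t) : SameType L t s :=
  fun φ => (h φ).symm

theorem comp (h : SameType L s t) (f : β → α) : SameType L (s ∘ f) (t ∘ f) := fun φ => by
  simpa only [Formula.realize_relabel] using h (φ.relabel f)

theorem of_finset (h : ∀ G : Finset α, SameType L (fun i : G => s i) (fun i : G => t i)) :
    SameType L s t := by
  classical
  intro φ
  have hs := BoundedFormula.realize_restrictFreeVar' (φ := φ)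
    (s := (φ.freeVarFinset : Set α)) subset_rfl (v := s) (xs := default)
  have ht := BoundedFormula.realize_restrictFreeVar' (φ := φ)
    (s := (φ.freeVarFinset : Set α)) subset_rfl (v := t) (xs := default)
  exact hs.symm.trans ((h φ.freeVarFinset _).trans ht)

theorem eq_iff (h : SameType L s t) (i j : α) : s i = s j ↔ t i = t j := by
  simpa using h (Term.equal (Term.var i) (Term.var j))

theorem isElementaryRel (h : SameType L s t) :
    IsElementaryRel L (Set.range fun i => (s i, t i)) := by
  choose f hf using fun z : Set.range fun i => (s i, t i) => z.2
  have hs : (fun z : Set.range fun i => (s i, t i) => z.1.1) = s ∘ f :=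
    funext fun z => congrArg Prod.fst (hf z).symm
  have ht : (fun z : Set.range fun i => (s i, t i) => z.1.2) = t ∘ f :=
    funext fun z => congrArg Prod.snd (hf z).symm
  rw [IsElementaryRel, hs, ht]
  exact h.comp f

end SameType

theorem sameType_equiv_comp {α : Type*} (g : U ≃[L] V) (s : α → U) : SameType L s (g ∘ s) :=
  fun φ => (StrongHomClass.realize_formula g φ).symm

theorem IsSaturated.exists_realize_elim (hSat : IsSaturated L U) {α : Type*} {s : α → U}
    (hs : #(Set.range s) < #U) {m : ℕ} {p : Set (L.Formula (α ⊕ Fin m))}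
    (hp : ∀ q : Finset (L.Formula (α ⊕ Fin m)), (q : Set _) ⊆ p →
      ∃ x : Fin m → U, ∀ φ ∈ q, φ.Realize (Sum.elim s x)) :
    ∃ x : Fin m → U, ∀ φ ∈ p, φ.Realize (Sum.elim s x) := by
  classical
  let c : L.Formula (α ⊕ Fin m) → L[[Set.range s]].Formula (Fin m) := fun φ =>
    BoundedFormula.constantsVarsEquiv.symm (φ.relabel (Sum.map (Set.rangeFactorization s) id))
  have realize_c (φ) (x : Fin m → U) : (c φ).Realize x ↔ φ.Realize (Sum.elim s x) := by
    rw [Formula.Realize, ← BoundedFormula.realize_constantsVarsEquiv, Equiv.apply_symm_apply]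
    refine Formula.realize_relabel.trans (iff_of_eq (congrArg _ ?_))
    funext i
    rcases i with i | i <;> rfl
  obtain ⟨x, hx⟩ := hSat (Set.range s) hs m (c '' p) fun q hq => by
    obtain ⟨q', hq', rfl⟩ := Finset.subset_set_image_iff.1 hq
    obtain ⟨x, hx⟩ := hp q' hq'
    exact ⟨x, Finset.forall_mem_image.2 fun φ hφ => (realize_c φ x).2 (hx φ hφ)⟩
  exact ⟨x, fun φ hφ => (realize_c φ x).1 (hx _ ⟨φ, hφ, rfl⟩)⟩

namespace IsElementaryRel

variable {R S : Set (U × V)}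

theorem sameType {α : Type*} {s : α → U} {t : α → V} (h : IsElementaryRel L R)
    (hR : ∀ i, (s i, t i) ∈ R) : SameType L s t :=
  h.comp fun i => ⟨_, hR i⟩

theorem swap (h : IsElementaryRel L R) : IsElementaryRel L (Prod.swap ⁻¹' R) :=
  (h.comp fun z : Prod.swap ⁻¹' R => ⟨z.1.swap, z.2⟩).symm

theorem mono (h : IsElementaryRel L R) (hS : S ⊆ R) : IsElementaryRel L S :=
  h.sameType fun z => hS z.2

theorem isOfFiniteCharacter :
    Order.IsOfFiniteCharacter {R : Set (U × V) | IsElementaryRel L R} := by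
  classical
  refine fun R => ⟨fun h S hS _ => h.mono hS, fun h => SameType.of_finset fun G => ?_⟩
  have hG : IsElementaryRel L (G.image Subtype.val : Set (U × V)) :=
    h _ (fun z hz => by
      obtain ⟨y, -, rfl⟩ := Finset.mem_image.1 hz
      exact y.2) (Finset.finite_toSet _)
  exact hG.sameType fun i => Finset.mem_image_of_mem _ i.2

theorem exists_insert_left (hV : IsSaturated L V) (h : IsElementaryRel L R) (hR : #R < #V)
    (a : U) : ∃ b, IsElementaryRel L (insert (a, b) R) := by
  obtain ⟨x, hx⟩ := hV.exists_realize_elim (s := fun z : R => z.1.2) (mk_range_le.trans_lt hR)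
    (p := {φ : L.Formula (R ⊕ Fin 1) | φ.Realize (Sum.elim (fun z : R => z.1.1) fun _ => a)})
    fun q hq => by
      have hex := (h (Formula.iExs (Fin 1) (BoundedFormula.iInf fun φ : q => φ.1))).1
        (Formula.realize_iExs.2 ⟨fun _ => a, BoundedFormula.realize_iInf.2 fun φ => hq φ.2⟩)
      obtain ⟨x, hx⟩ := Formula.realize_iExs.1 hex
      exact ⟨x, fun φ hφ => BoundedFormula.realize_iInf.1 hx ⟨φ, hφ⟩⟩
  have hst : SameType L (Sum.elim (fun z : R => z.1.1) fun _ : Fin 1 => a)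
      (Sum.elim (fun z : R => z.1.2) x) := fun φ =>
    ⟨hx φ, fun hφ => by_contra fun hn => hx φ.not hn hφ⟩
  refine ⟨x 0, hst.isElementaryRel.mono ?_⟩
  rintro z (rfl | hz)
  · exact ⟨Sum.inr 0, rfl⟩
  · exact ⟨Sum.inl ⟨z, hz⟩, rfl⟩

theorem exists_insert_right (hU : IsSaturated L U) (h : IsElementaryRel L R) (hR : #R < #U)
    (b : V) : ∃ a, IsElementaryRel L (insert (a, b) R) := by
  obtain ⟨a, ha⟩ := h.swap.exists_insert_left hU
    ((mk_preimage_equiv (Equiv.prodComm V U) R).trans_lt hR) b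
  refine ⟨a, ha.swap.mono ?_⟩
  rintro z (rfl | hz)
  · exact Or.inl rfl
  · exact Or.inr (by simpa using hz)

theorem exists_equiv_of_total (h : IsElementaryRel L R) (hl : ∀ a, ∃ b, (a, b) ∈ R)
    (hr : ∀ b, ∃ a, (a, b) ∈ R) : ∃ g : U ≃[L] V, ∀ z ∈ R, g z.1 = z.2 := by
  choose f hf using hl
  have fst_eq_iff {z y : U × V} (hz : z ∈ R) (hy : y ∈ R) : z.1 = y.1 ↔ z.2 = y.2 :=
    SameType.eq_iff h ⟨z, hz⟩ ⟨y, hy⟩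
  have hbij : Function.Bijective f := by
    refine ⟨fun a b hab => (fst_eq_iff (hf a) (hf b)).2 hab, fun b => ?_⟩
    obtain ⟨a, ha⟩ := hr b
    exact ⟨a, (fst_eq_iff (hf a) ha).1 rfl⟩
  refine ⟨⟨Equiv.ofBijective f hbij, fun {n} φ x => ?_, fun {n} r x => ?_⟩,
    fun z hz => (fst_eq_iff (hf z.1) hz).1 rfl⟩
  · have hfun := (h.sameType (s := Sum.elim x fun _ : Unit => Structure.funMap φ x)
      (t := Sum.elim (f ∘ x) fun _ : Unit => f (Structure.funMap φ x))
      (by rintro (i | i) <;> exact hf _))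
      (Term.equal (Term.var (Sum.inr ())) (Term.func φ fun i => Term.var (Sum.inl i)))
    simpa [Function.comp_def] using hfun
  · have hrel := (h.sameType (s := x) (t := f ∘ x) fun i => hf _) (r.formula fun i => Term.var i)
    simpa [Formula.realize_rel, Function.comp_def] using hrel.symm

theorem exists_equiv (hU : IsSaturated L U) (hV : IsSaturated L V) (hUV : #U = #V)
    (hU₀ : ℵ₀ ≤ #U) (h : IsElementaryRel L R) (hR : #R < #U) :
    ∃ g : U ≃[L] V, ∀ z ∈ R, g z.1 = z.2 := by
  obtain ⟨S, hS, hRS, hSUV⟩ := exists_superset_of_isOfFiniteCharacter (ι := U ⊕ V)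
    isOfFiniteCharacter hU₀
    (by rw [mk_sum, lift_id, lift_id, ← hUV, add_eq_self hU₀])
    (C := Sum.elim (fun a z => z.1 = a) fun b z => z.2 = b)
    (fun R hR hRU i => by
      rcases i with a | b
      · exact (exists_insert_left hV hR (hRU.trans_eq hUV) a).elim fun b hb => ⟨(a, b), rfl, hb⟩
      · exact (exists_insert_right hU hR hRU b).elim fun a ha => ⟨(a, b), rfl, ha⟩) h hR
  obtain ⟨g, hg⟩ := exists_equiv_of_total hS
    (fun a => (hSUV (Sum.inl a)).elim fun z hz => ⟨z.2, hz.2 ▸ hz.1⟩)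
    (fun b => (hSUV (Sum.inr b)).elim fun z hz => ⟨z.1, hz.2 ▸ hz.1⟩)
  exact ⟨g, fun z hz => hg z (hRS hz)⟩

end IsElementaryRel

namespace SameTypeOver

variable {B : Set U} {α β : Type*} {s t : α → U}

protected theorem symm (h : SameTypeOver L B s t) : SameTypeOver L B t s :=
  SameType.symm h

theorem sameType (h : SameTypeOver L B s t) : SameType L s t :=
  SameType.comp h Sum.inr

protected theorem comp (h : SameTypeOver L B s t) (f : β → α) :
    SameTypeOver L B (s ∘ f) (t ∘ f) := by
  simpa only [SameTypeOver, Sum.elim_comp_map, Function.comp_id] using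
    SameType.comp h (Sum.map id f)

theorem exists_equiv [Finite α] (hSat : IsSaturated L U) (hU : ℵ₀ ≤ #U) (hB : #B < #U)
    (h : SameTypeOver L B s t) : ∃ g ∈ autOver L B, g ∘ s = t := by
  have hrange : (Set.range fun i => (Sum.elim ((↑) : B → U) s i, Sum.elim ((↑) : B → U) t i)) =
      Set.range (fun b : B => (b.1, b.1)) ∪ Set.range fun i => (s i, t i) := by
    simp only [Set.range, Sum.exists, Sum.elim_inl, Sum.elim_inr]
    rfl
  have hcard : #(Set.range fun i => (Sum.elim ((↑) : B → U) s i, Sum.elim ((↑) : B → U) t i)) <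
      #U := by
    rw [hrange]
    exact (mk_union_le _ _).trans_lt (add_lt_of_lt hU (mk_range_le.trans_lt hB)
      ((Set.finite_range _).lt_aleph0.trans_le hU))
  obtain ⟨g, hg⟩ := (SameType.isElementaryRel h).exists_equiv hSat hSat rfl hU hcard
  exact ⟨g, fun b hb => hg _ ⟨Sum.inl ⟨b, hb⟩, rfl⟩, funext fun i => hg _ ⟨Sum.inr i, rfl⟩⟩

end SameTypeOver

theorem sameTypeOver_comp_of_mem_autOver {B : Set U} {g : U ≃[L] U} (hg : g ∈ autOver L B)
    {α : Type*} (s : α → U) : SameTypeOver L B s (g ∘ s) := by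
  have hgB : g ∘ ((↑) : B → U) = (↑) := funext fun b => hg b b.2
  simpa only [SameTypeOver, Sum.comp_elim, hgB] using
    sameType_equiv_comp g (Sum.elim ((↑) : B → U) s)

end Types

section Average

variable {L : FirstOrder.Language.{u, v}} {U : Type w} [L.Structure U]
  {M : L.ElementarySubstructure U} {n : ℕ} {F : Ultrafilter (Fin n → M)}

/-- The tuple `c` realizes over `B` the average type of the ultrafilter `F`. Since `F` concentrates
on tuples of the model `M`, this type is finitely satisfiable in `M`: it is a coheir. -/
def IsAverage (F : Ultrafilter (Fin n → M)) (B : Set U) (c : Fin n → U) : Prop :=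
  ∀ φ : L.Formula (B ⊕ Fin n), φ.Realize (Sum.elim (↑) c) ↔
    ∀ᶠ x : Fin n → M in F, φ.Realize (Sum.elim (↑) fun i => (x i : U))

/-- The sequence `c` is a Morley sequence over `M` of the average type of `F`. -/
def IsMorley (F : Ultrafilter (Fin n → M)) {I : Type*} [Preorder I] (c : I → Fin n → U) : Prop :=
  ∀ i, IsAverage F (M ∪ ⋃ j : Set.Iio i, Set.range (c j)) (c i)

namespace IsAverage

variable {B C : Set U} {c d : Fin n → U}

theorem realize_iff (h : IsAverage F B c) {α : Type*} {t : α → U} (ht : ∀ i, t i ∈ B)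
    (φ : L.Formula (α ⊕ Fin n)) : φ.Realize (Sum.elim t c) ↔
      ∀ᶠ x : Fin n → M in F, φ.Realize (Sum.elim t fun i => (x i : U)) := by
  have realize_relabel (x : Fin n → U) :
      (φ.relabel (Sum.map (fun i => (⟨t i, ht i⟩ : B)) id)).Realize (Sum.elim (↑) x) ↔
        φ.Realize (Sum.elim t x) := by
    rw [Formula.realize_relabel, Sum.elim_comp_map, Function.comp_id]
    rfl
  simpa only [realize_relabel] using h (φ.relabel (Sum.map (fun i => (⟨t i, ht i⟩ : B)) id))

theorem mono (h : IsAverage F B c) (hCB : C ⊆ B) : IsAverage F C c :=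
  fun φ => h.realize_iff (fun i => hCB i.2) φ

theorem of_sameTypeOver (h : IsAverage F B c) (hcd : SameTypeOver L B c d) : IsAverage F B d :=
  fun φ => (hcd φ).symm.trans (h φ)

theorem sameTypeOver_elim {α : Type*} {s t : α → U} (hst : SameTypeOver L (M : Set U) s t)
    (hc : IsAverage F (M ∪ Set.range s) c) (hd : IsAverage F (M ∪ Set.range t) d) :
    SameTypeOver L (M : Set U) (Sum.elim s c) (Sum.elim t d) := by
  have elim_mem (s : α → U) (i) :
      Sum.elim ((↑) : ↥(M : Set U) → U) s i ∈ (M ∪ Set.range s : Set U) :=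
    i.rec (fun m => Or.inl m.2) fun i => Or.inr (Set.mem_range_self i)
  have helim : SameType L (Sum.elim (Sum.elim ((↑) : ↥(M : Set U) → U) s) c)
      (Sum.elim (Sum.elim ((↑) : ↥(M : Set U) → U) t) d) := fun φ => by
    rw [hc.realize_iff (elim_mem s), hd.realize_iff (elim_mem t)]
    refine Filter.eventually_congr (.of_forall fun x => ?_)
    convert SameType.comp hst (Sum.elim id (Sum.inl ∘ x)) φ using 2 <;>
    · rw [Sum.comp_elim]
      rfl
  rw [SameTypeOver]
  convert helim.comp (Equiv.sumAssoc (M : Set U) α (Fin n)).symm using 1 <;>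
  · ext (i | i | i) <;> rfl

end IsAverage

theorem exists_isAverage (hSat : IsSaturated L U) (F : Ultrafilter (Fin n → M)) {B : Set U}
    (hB : #B < #U) : ∃ c, IsAverage F B c := by
  obtain ⟨c, hc⟩ := hSat.exists_realize_elim (s := ((↑) : B → U)) (by rwa [Subtype.range_coe])
    (p := {φ | ∀ᶠ x : Fin n → M in F, φ.Realize (Sum.elim (↑) fun i => (x i : U))})
    fun q hq => ((Finset.eventually_all q).2 hq).exists.imp' _ fun x hx => hx
  exact ⟨c, fun φ => ⟨fun hφ => by_contra fun hn =>
    hc φ.not (Ultrafilter.eventually_not.2 hn) hφ, hc φ⟩⟩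

theorem exists_realize_elim_of_elementarySubstructure {α : Type*} (s : α → M)
    (φ : L.Formula (α ⊕ Fin n)) {a : Fin n → U}
    (h : φ.Realize (Sum.elim (fun i => (s i : U)) a)) :
    ∃ x : Fin n → M, φ.Realize (Sum.elim (fun i => (s i : U)) fun i => (x i : U)) := by
  have hex : (Formula.iExs (Fin n) φ).Realize (M.subtype ∘ s) := Formula.realize_iExs.2 ⟨a, h⟩
  rw [ElementaryEmbedding.map_formula, Formula.realize_iExs] at hex
  obtain ⟨x, hx⟩ := hex
  rw [← ElementaryEmbedding.map_formula M.subtype, Sum.comp_elim] at hx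
  exact ⟨x, hx⟩

variable (M) in
theorem exists_ultrafilter_isAverage (a : Fin n → U) :
    ∃ F : Ultrafilter (Fin n → M), IsAverage F M a := by
  classical
  let solutions (φ : L.Formula ((M : Set U) ⊕ Fin n)) : Set (Fin n → M) :=
    {x | φ.Realize (Sum.elim (↑) fun i => (x i : U))}
  obtain ⟨F, hF⟩ := Ultrafilter.exists_ultrafilter_of_finite_inter_nonempty
    (solutions '' {φ | φ.Realize (Sum.elim (↑) a)}) fun T hT => by
      obtain ⟨q, hq, rfl⟩ := Finset.subset_set_image_iff.1 hT
      obtain ⟨x, hx⟩ := exists_realize_elim_of_elementarySubstructure (M := M) id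
        (BoundedFormula.iInf fun φ : q => φ.1) (BoundedFormula.realize_iInf.2 fun φ => hq φ.2)
      refine ⟨x, fun S hS => ?_⟩
      obtain ⟨φ, hφ, rfl⟩ := Finset.mem_image.1 hS
      exact BoundedFormula.realize_iInf.1 hx ⟨φ, hφ⟩
  have eventually_of_realize {φ} (hφ : φ.Realize (Sum.elim (↑) a)) : solutions φ ∈ F :=
    hF ⟨φ, hφ, rfl⟩
  exact ⟨F, fun φ => ⟨eventually_of_realize, fun h => by_contra fun hn =>
    Ultrafilter.eventually_not.1 (eventually_of_realize (φ := φ.not) hn) h⟩⟩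

theorem exists_forall_isAverage (hSat : IsSaturated L U) (hU : ℵ₀ ≤ #U)
    (F : Ultrafilter (Fin n → M)) {J : Type w} [Preorder J] [WellFoundedLT J]
    (hJ : ∀ i : J, #(Set.Iio i) < #U) {B : Set U} (hB : #B < #U) :
    ∃ c : J → Fin n → U, ∀ i, IsAverage F (B ∪ ⋃ j : Set.Iio i, Set.range (c j)) (c i) := by
  refine exists_transfinite_choice
    (P := fun i f x => IsAverage F (B ∪ ⋃ j, Set.range (f j)) x) fun i f => ?_
  have hrange : ⋃ j, Set.range (f j) = Set.range (Function.uncurry f) := by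
    ext x
    simp
  have hcard : #(Set.range (Function.uncurry f)) < #U := by
    refine mk_range_le.trans_lt ?_
    rw [mk_prod, lift_uzero]
    exact mul_lt_of_lt hU (hJ i) ((lift_lt_aleph0.2 (lt_aleph0_of_finite _)).trans_le hU)
  rw [hrange]
  exact exists_isAverage hSat F ((mk_union_le _ _).trans_lt (add_lt_of_lt hU hB hcard))

theorem isMorley_recBotCoe {J : Type*} [Preorder J] {a : Fin n → U} {c : J → Fin n → U}
    {B : Set U} (hMB : (M : Set U) ⊆ B) (haB : Set.range a ⊆ B) (ha : IsAverage F M a)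
    (hc : ∀ i, IsAverage F (B ∪ ⋃ j : Set.Iio i, Set.range (c j)) (c i)) :
    IsMorley F (WithBot.recBotCoe (C := fun _ => Fin n → U) a c) := by
  intro i
  induction i using WithBot.recBotCoe with
  | bot =>
    exact ha.mono (Set.union_subset subset_rfl
      (Set.iUnion_subset fun j => (not_lt_bot (Set.mem_Iio.1 j.2)).elim))
  | coe i =>
    refine (hc i).mono (Set.union_subset (hMB.trans Set.subset_union_left)
      (Set.iUnion_subset fun j => ?_))
    obtain ⟨j, hj⟩ := j
    induction j using WithBot.recBotCoe with
    | bot => exact haB.trans Set.subset_union_left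
    | coe j =>
      exact Set.subset_union_of_subset_right (Set.subset_iUnion
        (fun j : Set.Iio i => Set.range (c j)) ⟨j, WithBot.coe_lt_coe.1 hj⟩) _

namespace IsMorley

variable {I J : Type*} {k : ℕ}

protected theorem comp [Preorder I] [Preorder J] {c : I → Fin n → U} (h : IsMorley F c)
    {f : J → I} (hf : StrictMono f) : IsMorley F (c ∘ f) := fun i =>
  (h (f i)).mono (Set.union_subset_union_right _ (Set.iUnion_subset fun j =>
    Set.subset_iUnion_of_subset ⟨f j, hf j.2⟩ subset_rfl))

theorem sameTypeOver {c d : Fin k → Fin n → U} (hc : IsMorley F c) (hd : IsMorley F d) :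
    SameTypeOver L (M : Set U) (Function.uncurry c) (Function.uncurry d) := by
  induction k with
  | zero =>
    obtain rfl : c = d := Subsingleton.elim c d
    exact fun _ => Iff.rfl
  | succ k ih =>
    have isAverage_last {c : Fin (k + 1) → Fin n → U} (hc : IsMorley F c) :
        IsAverage F (M ∪ Set.range (Function.uncurry (c ∘ Fin.castSucc))) (c (Fin.last k)) := by
      refine (hc (Fin.last k)).mono (Set.union_subset_union_right _ ?_)
      rintro _ ⟨⟨i, l⟩, rfl⟩
      exact Set.mem_iUnion.2 ⟨⟨i.castSucc, i.castSucc_lt_last⟩, l, rfl⟩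
    have uncurry_eq (c : Fin (k + 1) → Fin n → U) : Function.uncurry c =
        Sum.elim (Function.uncurry (c ∘ Fin.castSucc)) (c (Fin.last k)) ∘ fun p =>
          Fin.lastCases (motive := fun _ => Fin k × Fin n ⊕ Fin n) (Sum.inr p.2)
            (fun i => Sum.inl (i, p.2)) p.1 := by
      ext ⟨i, l⟩
      induction i using Fin.lastCases <;> simp
    rw [uncurry_eq c, uncurry_eq d]
    exact (IsAverage.sameTypeOver_elim
      (ih (hc.comp Fin.strictMono_castSucc) (hd.comp Fin.strictMono_castSucc))
      (isAverage_last hc) (isAverage_last hd)).comp _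

theorem exists_equiv (hSat : IsSaturated L U) (hU : ℵ₀ ≤ #U) (hM : #M < #U)
    {c d : Fin k → Fin n → U} (hc : IsMorley F c) (hd : IsMorley F d) :
    ∃ g ∈ autOver L (M : Set U), ∀ i, g ∘ c i = d i := by
  obtain ⟨g, hg, hgcd⟩ := (hc.sameTypeOver hd).exists_equiv hSat hU hM
  exact ⟨g, hg, fun i => funext fun l => congrFun hgcd (i, l)⟩

theorem pair [Preorder I] {c : I → Fin n → U} (hc : IsMorley F c) {i j : I} (hij : i < j) :
    IsMorley F ![c i, c j] := by
  have hmono : StrictMono ![i, j] := Fin.strictMono_iff_lt_succ.2 fun l => by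
    fin_cases l
    exact hij
  convert hc.comp hmono using 1
  ext l
  fin_cases l <;> rfl

theorem eq_iff_eq {a b c d : Fin n → U} (hab : IsMorley F ![a, b]) (hcd : IsMorley F ![c, d]) :
    a = b ↔ c = d := by
  simp only [funext_iff]
  exact forall_congr' fun l => (hab.sameTypeOver hcd).sameType.eq_iff (0, l) (1, l)

end IsMorley

end Average

section Expansion

variable {L : FirstOrder.Language.{u, v}} {U : Type w} [L.Structure U]

theorem mem_image_comp_iff (g : U ≃[L] U) {n : ℕ} {D : Set (Fin n → U)} {x : Fin n → U} :
    x ∈ (g ∘ ·) '' D ↔ g.symm ∘ x ∈ D := by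
  obtain ⟨y, rfl⟩ := g.surjective.comp_left x
  have hy : g.symm ∘ g ∘ y = y := funext fun i => g.symm_apply_apply (y i)
  rw [g.injective.comp_left.mem_set_image, hy]

/-- An automorphism `g` of `U` such that `g ∘ x ∈ C ↔ x ∈ D` is an isomorphism from `⟨U, D⟩` to
`⟨U, C⟩`. -/
def expansionEquiv {n : ℕ} (g : U ≃[L] U) {D C : Set (Fin n → U)} (h : ∀ x, g ∘ x ∈ C ↔ x ∈ D) :
    @Language.Equiv (expLang L n) U U (expansion L D) (expansion L C) :=
  @Language.Equiv.mk (expLang L n) U U (expansion L D) (expansion L C) g.toEquiv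
    (fun {_} f x => match f with
      | .inl f => g.map_fun f x
      | .inr f => Empty.elim f)
    (fun {_} r x => by
      rcases r with r | r
      · exact g.map_rel r x
      · cases r
        exact h x)

theorem image_comp_mem_eqClass {n : ℕ} (g : U ≃[L] U) (D : Set (Fin n → U)) :
    (g ∘ ·) '' D ∈ eqClass L D := by
  let _ := expansion L D
  exact Eq.symm (@StrongHomClass.elementarilyEquivalent (expLang L n) U U _
    (expansion L ((g ∘ ·) '' D)) _ _ (@Equiv.instStrongHomClass (expLang L n) U U _
    (expansion L ((g ∘ ·) '' D)))
    (expansionEquiv g fun _ => g.injective.comp_left.mem_set_image))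

theorem eqClass_eq_of_mem {n : ℕ} {C D : Set (Fin n → U)} (h : C ∈ eqClass L D) :
    eqClass L C = eqClass L D :=
  Set.ext fun _ => ⟨fun hE => Eq.trans hE h, fun hE => Eq.trans hE (Eq.symm h)⟩

theorem DefinableWith.mem_iff {n m : ℕ} {A : Set U} {D : Set (Fin n → U)} {S : Set (Fin m → U)}
    (hS : DefinableWith L A D S) {g : U ≃[L] U} (hg : g ∈ autOver L A)
    (h : ∀ x, g ∘ x ∈ D ↔ x ∈ D) (x : Fin m → U) : g ∘ x ∈ S ↔ x ∈ S := by
  let _ := expansion L D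
  obtain ⟨φ, rfl⟩ := Set.definable_iff_exists_formula_sum.1 hS
  have hgx : expansionEquiv g h ∘ Sum.elim (fun a : A => (a : U)) x =
      Sum.elim (fun a : A => (a : U)) (g ∘ x) := by
    rw [Sum.comp_elim]
    exact congrArg (Sum.elim · _) (funext fun a : A => hg a a.2)
  exact (hgx ▸ StrongHomClass.realize_formula (L := expLang L n) (expansionEquiv g h) φ :)

section Substitution

variable {m n : ℕ} {α : Type*}

/-- A term of `L` with an `n`-ary predicate, as a term of `L` with an `m`-ary predicate. -/
def substPredTerm : (expLang L n).Term α → (expLang L m).Term α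
  | .var i => .var i
  | .func (Sum.inl f) ts => .func (Sum.inl f) fun i => substPredTerm (ts i)
  | .func (Sum.inr f) _ => Empty.elim f

/-- The formula obtained by replacing the `n`-ary predicate by the formula `θ`, which involves an
`m`-ary predicate. -/
def substPred (θ : (expLang L m).Formula (Fin n)) :
    {k : ℕ} → (expLang L n).BoundedFormula α k → (expLang L m).BoundedFormula α k
  | _, .falsum => .falsum
  | _, .equal s t => .equal (substPredTerm s) (substPredTerm t)
  | _, .rel (Sum.inl r) ts => .rel (Sum.inl r) fun i => substPredTerm (ts i)
  | _, .rel (Sum.inr .mem) ts =>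
    BoundedFormula.relabel id (BoundedFormula.subst θ fun i => substPredTerm (ts i))
  | _, .imp φ ψ => .imp (substPred θ φ) (substPred θ ψ)
  | _, .all φ => .all (substPred θ φ)

theorem realize_substPredTerm {D : Set (Fin n → U)} {E : Set (Fin m → U)}
    (t : (expLang L n).Term α) (s : α → U) :
    @Term.realize (expLang L m) U (expansion L E) α s (substPredTerm t) =
      @Term.realize (expLang L n) U (expansion L D) α s t := by
  induction t with
  | var i => rfl
  | func f ts ih =>
    rcases f with f | f
    · exact congrArg (Structure.funMap f) (funext ih)
    · exact Empty.elim f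

theorem realize_substPred {θ : (expLang L m).Formula (Fin n)} {D : Set (Fin n → U)}
    {E : Set (Fin m → U)}
    (hθ : ∀ x, @Formula.Realize (expLang L m) U (expansion L E) _ θ x ↔ x ∈ D)
    {k : ℕ} (φ : (expLang L n).BoundedFormula α k) (s : α → U) (xs : Fin k → U) :
    @BoundedFormula.Realize (expLang L m) U (expansion L E) α k (substPred θ φ) s xs ↔
      @BoundedFormula.Realize (expLang L n) U (expansion L D) α k φ s xs := by
  induction φ with
  | falsum => rfl
  | equal t₁ t₂ =>
    exact iff_of_eq (congrArg₂ Eq (realize_substPredTerm t₁ _) (realize_substPredTerm t₂ _))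
  | rel r ts =>
    rcases r with r | r
    · exact iff_of_eq
        (congrArg (Structure.RelMap r) (funext fun i => realize_substPredTerm (ts i) _))
    · cases r
      let _ := expansion L E
      refine BoundedFormula.realize_relabel.trans (BoundedFormula.realize_subst.trans ?_)
      refine Iff.trans ?_ (hθ _)
      exact iff_of_eq (congrArg₂ _ (funext fun i => realize_substPredTerm (ts i) _)
        (Subsingleton.elim _ _))
  | imp φ ψ ih₁ ih₂ => exact imp_congr (ih₁ xs) (ih₂ xs)
  | all φ ih => exact forall_congr' fun a => ih _

end Substitution

variable (L) in
/-- The set `Φ E` is defined in `⟨U, E⟩`, without parameters, by a formula that does not depend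
on `E`. -/
def UniformlyDefinable {m n : ℕ} (Φ : Set (Fin m → U) → Set (Fin n → U)) : Prop :=
  ∃ θ : (expLang L m).Formula (Fin n), ∀ E x,
    letI := expansion L E
    θ.Realize x ↔ x ∈ Φ E

namespace UniformlyDefinable

variable {k m n : ℕ} {Φ Ψ : Set (Fin m → U) → Set (Fin n → U)}

protected theorem id : UniformlyDefinable L (id : Set (Fin n → U) → Set (Fin n → U)) :=
  ⟨Relations.formula (Sum.inr PredSymbol.mem : (expLang L n).Relations n) Term.var, fun E _ =>
    letI := expansion L E
    Formula.realize_rel⟩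

theorem inter (hΦ : UniformlyDefinable L Φ) (hΨ : UniformlyDefinable L Ψ) :
    UniformlyDefinable L fun E => Φ E ∩ Ψ E := by
  obtain ⟨θ, hθ⟩ := hΦ
  obtain ⟨η, hη⟩ := hΨ
  exact ⟨θ ⊓ η, fun E x =>
    letI := expansion L E
    Formula.realize_inf.trans (and_congr (hθ E x) (hη E x))⟩

theorem preimage_comp (hΦ : UniformlyDefinable L Φ) (f : Fin n → Fin k) :
    UniformlyDefinable L fun E => {x | x ∘ f ∈ Φ E} := by
  obtain ⟨θ, hθ⟩ := hΦ
  exact ⟨θ.relabel f, fun E x =>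
    letI := expansion L E
    Formula.realize_relabel.trans (hθ E (x ∘ f))⟩

theorem image_comp (hΦ : UniformlyDefinable L Φ) (f : Fin k → Fin n) :
    UniformlyDefinable L fun E => (· ∘ f) '' Φ E := by
  obtain ⟨θ, hθ⟩ := hΦ
  refine ⟨Formula.iExs (Fin n) (θ.relabel Sum.inr ⊓ BoundedFormula.iInf fun i =>
    Term.equal (Term.var (Sum.inr (f i))) (Term.var (Sum.inl i))), fun E x => ?_⟩
  let _ := expansion L E
  refine Formula.realize_iExs.trans (exists_congr fun y => ?_)
  refine Formula.realize_inf.trans (and_congr (Formula.realize_relabel.trans (hθ E y)) ?_)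
  refine BoundedFormula.realize_iInf.trans (Iff.trans ?_ funext_iff.symm)
  exact forall_congr' fun i => Formula.realize_equal

theorem nonempty_iff (hΦ : UniformlyDefinable L Φ) {C E : Set (Fin m → U)}
    (h : C ∈ eqClass L E) : (Φ C).Nonempty ↔ (Φ E).Nonempty := by
  obtain ⟨θ, hθ⟩ := hΦ
  let ψ : (expLang L m).Sentence := Formula.iExs (α := Empty) (Fin n) (θ.relabel Sum.inr)
  have hψ (E : Set (Fin m → U)) : @Sentence.Realize (expLang L m) U (expansion L E) ψ ↔
      (Φ E).Nonempty := by
    let _ := expansion L E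
    exact Formula.realize_iExs.trans (exists_congr fun x => Formula.realize_relabel.trans (hθ E x))
  rw [← hψ, ← hψ]
  exact (@elementarilyEquivalent_iff _ _ _ (expansion L C) (expansion L E)).1 h ψ

theorem mem_eqClass (hΦ : UniformlyDefinable L Φ) {C E : Set (Fin m → U)}
    (h : C ∈ eqClass L E) : Φ C ∈ eqClass L (Φ E) := by
  obtain ⟨θ, hθ⟩ := hΦ
  refine (@elementarilyEquivalent_iff _ _ _ (expansion L (Φ C)) (expansion L (Φ E))).2 fun φ => ?_
  refine (realize_substPred (hθ C) φ _ _).symm.trans (Iff.trans ?_ (realize_substPred (hθ E) φ _ _))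
  exact (@elementarilyEquivalent_iff _ _ _ (expansion L C) (expansion L E)).1 h (substPred θ φ)

end UniformlyDefinable

variable {n : ℕ} {D : Set (Fin n → U)}

theorem definableWith_prodCompl (A : Set U) (D : Set (Fin n → U)) :
    DefinableWith L A D (prodCompl D) := by
  let _ := expansion L D
  have hD : A.Definable (expLang L n) D := by
    obtain ⟨θ, hθ⟩ := UniformlyDefinable.id (L := L) (U := U) (n := n)
    exact (Set.empty_definable_iff.2 ⟨θ, Set.ext fun x => (hθ D x).symm⟩).mono
      (Set.empty_subset A)
  exact (hD.preimage_comp (Fin.castAdd n)).inter (hD.preimage_comp (Fin.natAdd n)).compl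

theorem append_mem_prodCompl {x y : Fin n → U} :
    Fin.append x y ∈ prodCompl D ↔ x ∈ D ∧ y ∉ D := by
  simp only [prodCompl, Set.mem_ofPred_eq, Fin.append_left, Fin.append_right]

theorem image_castAdd_prodCompl (hD : Dᶜ.Nonempty) : (· ∘ Fin.castAdd n) '' prodCompl D = D := by
  obtain ⟨y, hy⟩ := hD
  refine Set.Subset.antisymm (Set.image_subset_iff.2 fun x hx => hx.1) fun x hx =>
    ⟨Fin.append x y, append_mem_prodCompl.2 ⟨hx, hy⟩, ?_⟩
  ext i
  exact Fin.append_left x y i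

theorem exists_subset_prodCompl (hD : Dᶜ.Nonempty) {C : Set (Fin (n + n) → U)}
    (hC : C ∈ eqClass L (prodCompl D)) : ∃ D' ∈ eqClass L D, C ⊆ prodCompl D' := by
  have hfst := (UniformlyDefinable.id (L := L) (U := U) (n := n + n)).image_comp (Fin.castAdd n)
  refine ⟨(· ∘ Fin.castAdd n) '' C, ?_, fun x hx => ⟨Set.mem_image_of_mem _ hx, fun hx' => ?_⟩⟩
  · simpa only [id, image_castAdd_prodCompl hD] using hfst.mem_eqClass hC
  · -- No element of `prodCompl D` has a second half that is a first half of such an element.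
    obtain ⟨y, hy, hy'⟩ := ((UniformlyDefinable.id.inter (hfst.preimage_comp
      (Fin.natAdd n))).nonempty_iff hC).1 ⟨x, hx, hx'⟩
    rw [Set.mem_ofPred_eq, id, image_castAdd_prodCompl hD] at hy'
    exact hy.2 hy'

end Expansion

section Invariance

variable {L : FirstOrder.Language.{u, v}} {U : Type w} [L.Structure U] {A : Set U} {n m : ℕ}
  {D : Set (Fin n → U)}

theorem symm_mem_autOver {g : U ≃[L] U} (hg : g ∈ autOver L A) : g.symm ∈ autOver L A :=
  fun a ha => by simpa only [g.symm_apply_apply] using congrArg g.symm (hg a ha).symm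

theorem invariantOver_iff :
    InvariantOver L A D ↔ ∀ g ∈ autOver L A, ∀ x, g ∘ x ∈ D ↔ x ∈ D := by
  constructor
  · intro h g hg x
    have himage : (g.symm ∘ ·) '' D = D := h.subset ⟨g.symm, symm_mem_autOver hg, rfl⟩
    conv_rhs => rw [← himage]
    exact (mem_image_comp_iff g.symm).symm
  · refine fun h => Set.eq_singleton_iff_unique_mem.2
      ⟨⟨Language.Equiv.refl L U, fun a _ => rfl, (Set.image_id D).symm⟩, ?_⟩
    rintro _ ⟨g, hg, rfl⟩
    exact Set.ext fun x => (mem_image_comp_iff g).trans (h _ (symm_mem_autOver hg) x)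

theorem exists_sameTypeOver_of_not_invariantOver (h : ¬ InvariantOver L A D) :
    ∃ a ∈ D, ∃ b ∉ D, SameTypeOver L A a b := by
  simp only [invariantOver_iff, not_forall] at h
  obtain ⟨g, hg, x, hx⟩ := h
  have hgx := sameTypeOver_comp_of_mem_autOver hg x
  by_cases hxD : x ∈ D
  · exact ⟨x, hxD, g ∘ x, fun hgxD => hx (iff_of_true hgxD hxD), hgx⟩
  · exact ⟨g ∘ x, by_contra fun hgxD => hx (iff_of_false hgxD hxD), x, hxD, hgx.symm⟩

theorem exists_elementarySubstructure_eq_image (M : L.ElementarySubstructure U) (g : U ≃[L] U) :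
    ∃ N : L.ElementarySubstructure U, (N : Set U) = g '' M := by
  let j : M ↪ₑ[L] U := g.toElementaryEmbedding.comp M.subtype
  let e := j.toEmbedding.equivRange
  refine ⟨⟨j.toEmbedding.toHom.range, fun k φ x => ?_⟩, ?_⟩
  · obtain ⟨y, rfl⟩ := e.surjective.comp_left x
    rw [StrongHomClass.realize_formula e φ]
    exact j.map_formula φ y
  · ext x
    constructor
    · rintro ⟨y, rfl⟩
      exact ⟨y, y.2, rfl⟩
    · rintro ⟨y, hy, rfl⟩
      exact ⟨⟨y, hy⟩, rfl⟩

theorem exists_small_elementarySubstructure (hU : ℵ₀ < #U)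
    (hL : lift.{w} L.card < lift.{max u v} #U) (hA : #A < #U) :
    ∃ M : L.ElementarySubstructure U, #M < #U ∧ A ⊆ M := by
  have hL' : lift.{w} L.card < lift.{max u v w} #U :=
    hL.trans_eq (congrFun lift_umax.{w, max u v} _).symm
  obtain ⟨M, hAM, hM⟩ := exists_elementarySubstructure_card_eq L A
    (max ℵ₀ (max (lift.{max u v} #A) (lift.{w} L.card))) (le_max_left _ _)
    (by simp) (by simp) (by
      simp only [lift_max, lift_aleph0, lift_lift, max_le_iff]
      exact ⟨aleph0_le_lift.2 hU.le, lift_le.2 hA.le, hL'.le⟩)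
  refine ⟨M, lift_lt.{w, max u v w}.1 (hM.trans_lt ?_), hAM⟩
  simp only [lift_max, lift_aleph0, lift_lift, max_lt_iff]
  exact ⟨aleph0_lt_lift.2 hU, lift_lt.2 hA, hL'⟩

theorem mk_formula_lt {κ : Cardinal.{w}} (hκ : ℵ₀ < κ)
    (hL : lift.{w} L.card < lift.{max u v} κ) {α : Type w} (hα : #α < κ) :
    #(L.Formula α) < lift.{max u v} κ := by
  have hle : #(L.Formula α) ≤ #(Σ k, L.BoundedFormula α k) :=
    mk_le_of_injective (f := Sigma.mk 0) sigma_mk_injective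
  refine (hle.trans BoundedFormula.card_le).trans_lt (max_lt (aleph0_lt_lift.2 hκ) ?_)
  exact add_lt_of_lt (aleph0_le_lift.2 hκ.le) (lift_lt.2 hα) hL

theorem exists_infinite_sameTypeOver (hU : ℵ₀ < #U) (hlim : IsStrongLimit #U)
    (hL : lift.{w} L.card < lift.{max u v} #U) {B : Set U} (hB : #B < #U)
    {K : Set (Fin m → U)} (hK : #K = #U) :
    ∃ T ⊆ K, T.Infinite ∧ ∀ x ∈ T, ∀ y ∈ T, SameTypeOver L B x y := by
  have hvars : #(B ⊕ Fin m) < #U := by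
    rw [mk_sum, lift_uzero]
    exact add_lt_of_lt hU.le hB ((lift_lt_aleph0.2 (lt_aleph0_of_finite _)).trans hU)
  have htypes : #(Set (L.Formula (B ⊕ Fin m))) < #(ULift.{max u v} K) := by
    obtain ⟨c, hc, hc'⟩ := lt_lift_iff.1 (mk_formula_lt hU hL hvars)
    rw [mk_uLift, hK, mk_set, ← hc', ← lift_two_power, lift_lt]
    exact hlim.isStrongPrelimit hc
  have : Infinite (ULift.{max u v} K) := by
    rw [infinite_iff, mk_uLift, hK]
    exact aleph0_le_lift.2 hU.le
  let type (x : ULift.{max u v} K) : Set (L.Formula (B ⊕ Fin m)) :=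
    {φ | φ.Realize (Sum.elim (↑) x.down.1)}
  obtain ⟨p, hp⟩ := exists_infinite_fiber type htypes
  refine ⟨(fun x : ULift.{max u v} K => x.down.1) '' (type ⁻¹' {p}), ?_,
    (Set.infinite_coe_iff.1 hp).image fun x _ y _ h => ULift.ext _ _ (Subtype.ext h), ?_⟩
  · rintro _ ⟨x, -, rfl⟩
    exact x.down.2
  · rintro _ ⟨x, hx, rfl⟩ _ ⟨y, hy, rfl⟩ φ
    exact Set.ext_iff.1 (Eq.trans hx (Eq.symm hy)) φ

namespace LascarInvariantOver

theorem of_definableWith (hD : LascarInvariantOver L A D) {S : Set (Fin m → U)}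
    (hS : DefinableWith L A D S) : LascarInvariantOver L A S := fun M hM hAM =>
  invariantOver_iff.2 fun g hg => hS.mem_iff (fun a ha => hg a (hAM ha))
    (invariantOver_iff.1 (hD M hM hAM) g hg)

theorem image_comp (hD : LascarInvariantOver L A D) {f : U ≃[L] U} (hf : f ∈ autOver L A) :
    LascarInvariantOver L A ((f ∘ ·) '' D) := by
  intro M hM hAM
  obtain ⟨N, hN⟩ := exists_elementarySubstructure_eq_image M f.symm
  have hNU : #(N : Set U) < #U := hN ▸ mk_image_le.trans_lt hM
  have hAN : A ⊆ N := fun a ha => hN ▸ ⟨a, hAM ha, symm_mem_autOver hf a ha⟩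
  refine invariantOver_iff.2 fun g hg x => ?_
  have hconj : f.symm.comp (g.comp f) ∈ autOver L (N : Set U) := by
    rw [hN]
    rintro _ ⟨a, ha, rfl⟩
    simpa using hg a ha
  obtain ⟨y, rfl⟩ := f.surjective.comp_left x
  rw [mem_image_comp_iff, f.injective.comp_left.mem_set_image]
  exact invariantOver_iff.1 (hD N hNU hAN) _ hconj y

theorem pseudoInvariantOver (hU : ℵ₀ < #U) (hlim : IsStrongLimit #U)
    (hL : lift.{w} L.card < lift.{max u v} #U) (hSat : IsSaturated L U) (hA : #A < #U)
    (hD : LascarInvariantOver L A D) : PseudoInvariantOver L A D := by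
  intro b hb K hKb hKU k
  obtain ⟨M, hM, hAM⟩ := exists_small_elementarySubstructure hU hL hA
  obtain ⟨T, hTK, hT, hTM⟩ := exists_infinite_sameTypeOver (B := (M : Set U)) hU hlim hL hM hKU
  obtain ⟨a, ha⟩ := hT.nonempty
  obtain ⟨f, hf, rfl⟩ := hKb (hTK ha)
  have hinv := invariantOver_iff.1 (hD.image_comp hf M hM hAM)
  have hTD : T ⊆ (f ∘ ·) '' D := fun y hy => by
    obtain ⟨g, hg, rfl⟩ := (hTM _ ha y hy).exists_equiv hSat hU.le hM
    exact (hinv g hg _).2 (Set.mem_image_of_mem _ hb)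
  exact ⟨_, image_comp_mem_eqClass f D, natCast_le_aleph0.trans
    ((aleph0_le_mk_iff.2 hT.to_subtype).trans (mk_le_mk_of_subset (Set.subset_inter hTK hTD)))⟩

end LascarInvariantOver

end Invariance

section Alternation

variable {L : FirstOrder.Language.{u, v}} {U : Type w} [L.Structure U] {A : Set U} {n : ℕ}
  {D : Set (Fin n → U)} {M : L.ElementarySubstructure U} {F : Ultrafilter (Fin n → M)}

theorem exists_isMorley_recBotCoe (hSat : IsSaturated L U) (hU : ℵ₀ ≤ #U) (hM : #M < #U)
    {a b : Fin n → U} (hab : SameTypeOver L (M : Set U) a b) {J : Type w} [Preorder J]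
    [WellFoundedLT J] (hJ : ∀ i : J, #(Set.Iio i) < #U) :
    ∃ (F : Ultrafilter (Fin n → M)) (c : J → Fin n → U),
      IsMorley F (WithBot.recBotCoe (C := fun _ => Fin n → U) a c) ∧
        IsMorley F (WithBot.recBotCoe (C := fun _ => Fin n → U) b c) := by
  obtain ⟨F, ha⟩ := exists_ultrafilter_isAverage M a
  have hrange (x : Fin n → U) : #(Set.range x) < #U :=
    (Set.finite_range x).lt_aleph0.trans_le hU
  have hB : #((M : Set U) ∪ (Set.range a ∪ Set.range b) : Set U) < #U :=
    (mk_union_le _ _).trans_lt (add_lt_of_lt hU hM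
      ((mk_union_le _ _).trans_lt (add_lt_of_lt hU (hrange a) (hrange b))))
  obtain ⟨c, hc⟩ := exists_forall_isAverage hSat hU F hJ hB
  exact ⟨F, c,
    isMorley_recBotCoe Set.subset_union_left
      (Set.subset_union_left.trans Set.subset_union_right) ha hc,
    isMorley_recBotCoe Set.subset_union_left
      (Set.subset_union_right.trans Set.subset_union_right) (ha.of_sameTypeOver hab) hc⟩

namespace IsMorley

variable {J : Type*} [LinearOrder J] {c : J → Fin n → U}

theorem injective_of_ne {a b : Fin n → U} (hab : a ≠ b)
    (ha : IsMorley F (WithBot.recBotCoe (C := fun _ => Fin n → U) a c))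
    (hb : IsMorley F (WithBot.recBotCoe (C := fun _ => Fin n → U) b c)) :
    Function.Injective c := by
  refine Function.Injective.of_lt_imp_ne fun i j hij hc => hab ?_
  have hcc := ha.pair (WithBot.coe_lt_coe.2 hij)
  have hai : a = c i := ((ha.pair (WithBot.bot_lt_coe i)).eq_iff_eq hcc).2 hc
  have hbi : b = c i := ((hb.pair (WithBot.bot_lt_coe i)).eq_iff_eq hcc).2 hc
  exact hai.trans hbi.symm

theorem shatters (hSat : IsSaturated L U) (hU : ℵ₀ ≤ #U) (hM : #M < #U) (hc : IsMorley F c)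
    {k : ℕ} {s t : Fin k → J} (hs : StrictMono s) (ht : StrictMono t)
    (hst : ∀ l l', l < l' → s l ≤ t l' ∧ t l ≤ s l') (hsD : ∀ l, c (s l) ∈ D)
    (htD : ∀ l, c (t l) ∉ D) : Shatters (eqClass L D) (Set.range (c ∘ s)) := by
  classical
  intro H hH
  -- Let `f` follow `s` on the indices sent into `H` and `t` on the others; the automorphism that
  -- moves `c ∘ f` to `c ∘ s` then moves `D` to a set with trace `H`.
  have s_ne_t (l l') : s l ≠ t l' := fun h => htD l' (h ▸ hsD l)
  let f (l : Fin k) : J := if c (s l) ∈ H then s l else t l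
  have hf : StrictMono f := fun l l' hl => by
    dsimp only [f]
    split_ifs
    · exact hs hl
    · exact (hst l l' hl).1.lt_of_ne (s_ne_t l l')
    · exact (hst l l' hl).2.lt_of_ne (s_ne_t l' l).symm
    · exact ht hl
  have hfD (l) : c (f l) ∈ D ↔ c (s l) ∈ H := by
    by_cases h : c (s l) ∈ H
    · simpa only [f, if_pos h, h, iff_true] using hsD l
    · simpa only [f, if_neg h, h, iff_false] using htD l
  obtain ⟨g, -, hg⟩ := (hc.comp hf).exists_equiv hSat hU hM (hc.comp hs)
  have hgD (l) : c (s l) ∈ (g ∘ ·) '' D ↔ c (s l) ∈ H := by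
    rw [← hfD l, ← show g ∘ c (f l) = c (s l) from hg l]
    exact g.injective.comp_left.mem_set_image
  refine ⟨(g ∘ ·) '' D, image_comp_mem_eqClass g D, Set.Subset.antisymm ?_ fun x hx => ?_⟩
  · rintro _ ⟨hxD, l, rfl⟩
    exact (hgD l).1 hxD
  · obtain ⟨l, rfl⟩ := hH hx
    exact ⟨(hgD l).2 hx, l, rfl⟩

end IsMorley

theorem LocallyCovers.exists_finset {u : Set (Set (Fin n → U))} {B : Set (Fin n → U)}
    (h : LocallyCovers u B) {ι : Type w} (hι : #ι = #U) {p : ι → Fin n → U}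
    (hp : Function.Injective p) (hpB : ∀ i, p i ∈ B) (N : ℕ) :
    ∃ C ∈ u, ∃ T : Finset ι, T.card = N ∧ ∀ i ∈ T, p i ∈ C := by
  obtain ⟨C, hC, hN⟩ := h (Set.range p) (Set.range_subset_iff.2 hpB) ((mk_range_eq p hp).trans hι) N
  rw [Set.inter_comm, ← Set.image_preimage_eq_inter_range] at hN
  obtain ⟨S, hSC, hSN⟩ := le_mk_iff_exists_subset.1 (hN.trans mk_image_le)
  obtain ⟨T, rfl, hTN⟩ := mk_set_eq_nat_iff_finset.1 hSN
  exact ⟨C, hC, T, hTN, fun i hi => hSC hi⟩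

theorem append_comp_mem_orbit {g : U ≃[L] U} (hg : g ∈ autOver L A) (x y : Fin n → U) :
    Fin.append (g ∘ x) (g ∘ y) ∈ orbit L A (Fin.append x y) :=
  ⟨g, hg, funext <| Fin.addCases
    (fun i => by simp only [Fin.append_left, Function.comp_apply])
    fun i => by simp only [Fin.append_right, Function.comp_apply]⟩

namespace PseudoInvariantOver

theorem exists_finset (hD : PseudoInvariantOver L A (prodCompl D)) {x y : Fin n → U}
    (hx : x ∈ D) (hy : y ∉ D) {ι : Type w} (hι : #ι = #U) {p q : ι → Fin n → U}
    (hp : Function.Injective p)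
    (hpq : ∀ i, Fin.append (p i) (q i) ∈ orbit L A (Fin.append x y)) (N : ℕ) :
    ∃ D' ∈ eqClass L D, ∃ T : Finset ι, T.card = N ∧ ∀ i ∈ T, p i ∈ D' ∧ q i ∉ D' := by
  have hinj : Function.Injective fun i => Fin.append (p i) (q i) := fun i j h =>
    hp (funext fun l => by simpa only [Fin.append_left] using congrFun h (Fin.castAdd n l))
  obtain ⟨C, hC, T, hTN, hTC⟩ :=
    (hD _ (append_mem_prodCompl.2 ⟨hx, hy⟩)).exists_finset hι hinj hpq N
  obtain ⟨D', hD', hCD'⟩ := exists_subset_prodCompl ⟨y, hy⟩ hC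
  exact ⟨D', hD', T, hTN, fun i hi => append_mem_prodCompl.1 (hCD' (hTC i hi))⟩

theorem not_finiteVCDim (hSat : IsSaturated L U) (hU : ℵ₀ ≤ #U) (hM : #M < #U)
    (hD : PseudoInvariantOver L A (prodCompl D)) {J : Type w} [LinearOrder J] (hJ : #J = #U)
    {c : J → Fin n → U} (hc : IsMorley F c) (hinj : Function.Injective c) {s t : J → J}
    (hs : StrictMono s) (ht : StrictMono t) (hst : ∀ i j, i < j → s i ≤ t j ∧ t i ≤ s j)
    {x y : Fin n → U} (hx : x ∈ D) (hy : y ∉ D)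
    (horbit : ∀ i, Fin.append (c (s i)) (c (t i)) ∈ orbit L A (Fin.append x y)) :
    ¬ FiniteVCDim (eqClass L D) := by
  classical
  rintro ⟨N, hN⟩
  have hcs : Function.Injective (c ∘ s) := hinj.comp hs.injective
  obtain ⟨D', hD', T, hTN, hT⟩ := hD.exists_finset hx hy hJ hcs horbit N
  let e : Fin N ↪o J := T.orderEmbOfFin hTN
  have heT (l) := hT (e l) (T.orderEmbOfFin_mem hTN l)
  have hshatters := hc.shatters hSat hU hM (hs.comp e.strictMono) (ht.comp e.strictMono)
    (fun l l' hl => hst _ _ (e.strictMono hl)) (fun l => (heT l).1) (fun l => (heT l).2)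
  refine hN (Finset.univ.image ((c ∘ s) ∘ e)) ?_ ?_
  · rw [Finset.card_image_of_injective _ (hcs.comp e.injective), Finset.card_fin]
  · rwa [Finset.coe_image, Finset.coe_univ, Set.image_univ, ← eqClass_eq_of_mem hD']

theorem lascarInvariantOver (hSat : IsSaturated L U) (hU : ℵ₀ ≤ #U)
    (hVC : FiniteVCDim (eqClass L D)) (hD : PseudoInvariantOver L A (prodCompl D)) :
    LascarInvariantOver L A D := by
  intro M hM hAM
  by_contra hinv
  obtain ⟨a, ha, b, hb, hab⟩ := exists_sameTypeOver_of_not_invariantOver hinv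
  let J := (#U).ord.ToType
  let _ : SuccOrder J := SuccOrder.ofLinearWellFoundedLT J
  have : NoMaxOrder J := Cardinal.noMaxOrder hU
  have hJ : #J = #U := mk_ord_toType _
  obtain ⟨i₀⟩ : Nonempty J := mk_ne_zero_iff.1 (hJ ▸ (aleph0_pos.trans_le hU).ne')
  obtain ⟨F, c, hac, hbc⟩ := exists_isMorley_recBotCoe (J := J) hSat hU hM hab
    fun i => (mk_Iio_lt i (by simp [J])).trans_eq hJ
  have hc : IsMorley F c := hac.comp WithBot.coe_strictMono
  have hinj : Function.Injective c :=
    IsMorley.injective_of_ne (fun hab' : a = b => hb (hab' ▸ ha)) hac hbc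
  have exists_conj {x y} (hxy : IsMorley F ![x, y]) (i : J) :
      ∃ g ∈ autOver L A, g ∘ x = c i ∧ g ∘ y = c (Order.succ i) := by
    obtain ⟨g, hg, hgxy⟩ := hxy.exists_equiv hSat hU hM (hc.pair (Order.lt_succ i))
    exact ⟨g, fun z hz => hg z (hAM hz), hgxy 0, hgxy 1⟩
  by_cases hi₀ : c i₀ ∈ D
  · refine hD.not_finiteVCDim hSat hU hM hJ hc hinj Order.succ_strictMono strictMono_id
      (fun _ _ h => ⟨Order.succ_le_of_lt h, h.le.trans (Order.le_succ _)⟩) hi₀ hb (fun i => ?_) hVC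
    obtain ⟨g, hg, hgb, hgc⟩ := exists_conj (hbc.pair (WithBot.bot_lt_coe i₀)) i
    exact hgc ▸ hgb ▸ append_comp_mem_orbit hg _ _
  · refine hD.not_finiteVCDim hSat hU hM hJ hc hinj strictMono_id Order.succ_strictMono
      (fun _ _ h => ⟨h.le.trans (Order.le_succ _), Order.succ_le_of_lt h⟩) ha hi₀ (fun i => ?_) hVC
    obtain ⟨g, hg, hga, hgc⟩ := exists_conj (hac.pair (WithBot.bot_lt_coe i₀)) i
    exact hgc ▸ hga ▸ append_comp_mem_orbit hg _ _

end PseudoInvariantOver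

end Alternation

end PseudoInv

theorem mainTheorem6_general (L : FirstOrder.Language.{u, v}) (U : Type w) [L.Structure U]
    (hU : Cardinal.aleph0 < Cardinal.mk U) (hlim : Cardinal.IsStrongLimit (Cardinal.mk U))
    (hL : Cardinal.lift.{w} L.card < Cardinal.lift.{max u v} (Cardinal.mk U))
    (hSat : PseudoInv.IsSaturated L U) (A : Set U) (hA : Cardinal.mk A < Cardinal.mk U)
    (n : ℕ) (D : Set (Fin n → U)) (hVC : PseudoInv.FiniteVCDim (PseudoInv.eqClass L D)) :
    List.TFAE [
      PseudoInv.LascarInvariantOver L A D,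
      ∀ (m : ℕ) (S : Set (Fin m → U)), PseudoInv.DefinableWith L A D S →
        PseudoInv.PseudoInvariantOver L A S,
      PseudoInv.PseudoInvariantOver L A (PseudoInv.prodCompl D)] := by
  tfae_have 1 → 2 := fun hD _ _ hS =>
    (hD.of_definableWith hS).pseudoInvariantOver hU hlim hL hSat hA
  tfae_have 2 → 3 := fun h => h _ _ (PseudoInv.definableWith_prodCompl A D)
  tfae_have 3 → 1 := fun h => h.lascarInvariantOver hSat hU.le hVC
  tfae_finish

theorem mainTheorem6 (L : FirstOrder.Language.{u, v}) (U : Type w) [L.Structure U]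
    (hInacc : Cardinal.IsInaccessible (Cardinal.mk U))
    (hRamsey : PseudoInv.IsRamsey (Cardinal.mk U))
    (hL : Cardinal.lift.{w} L.card < Cardinal.lift.{max u v} (Cardinal.mk U))
    (hSat : PseudoInv.IsSaturated L U)
    (A : Set U) (hA : Cardinal.mk A < Cardinal.mk U)
    (n : ℕ) (D : Set (Fin n → U))
    (hVC : PseudoInv.FiniteVCDim (PseudoInv.eqClass L D)) :
    List.TFAE [
      PseudoInv.LascarInvariantOver L A D,
      ∀ (m : ℕ) (S : Set (Fin m → U)), PseudoInv.DefinableWith L A D S →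
        PseudoInv.PseudoInvariantOver L A S,
      PseudoInv.PseudoInvariantOver L A (PseudoInv.prodCompl D)] :=
  mainTheorem6_general L U hInacc.aleph0_lt hInacc.isStrongLimit hL hSat A hA n D hVC
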